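/- Let $\{\alpha_n\}_{n\ge 0}$ be a sequence of complex numbers with $|\alpha_n|<1$ for all $n$ (a sequence of Verblunsky coefficients), let $\gamma\in(0,1)$, and assume that $$\sum_{n=0}^\infty n^\gamma|\alpha_n|^2<\infty .$$ For $\beta\in[0,2\pi)$ let $\Phi_n(z,\beta)$ be the monic polynomials with Verblunsky coefficients $\{e^{i\beta}\alpha_n\}_{n\ge 0}$, that is, $\Phi_0(z,\beta)=1$ and $$\Phi_{n+1}(z,\beta)=z\,\Phi_n(z,\beta)-\overline{e^{i\beta}\alpha_n}\,\Phi_n^*(z,\beta),\qquad \Phi_n^*(z,\beta)=z^n\,\overline{\Phi_n(1/\overline z,\beta)},\qquad n\ge 0 .$$ The Prüfer radius $R_n(\eta,\beta)>0$ is defined by the polar representation $\Phi_n(e^{i\eta},\beta)=R_n(\eta,\beta)\,e^{i(n\eta+\theta_n(\eta,\beta))}$ with $\theta_n(\eta,\beta)$ real; that is, $R_n(\eta,\beta)=|\Phi_n(e^{i\eta},\beta)|$. Let $\nu$ be a finite Borel measure on $(0,2\pi)$ such that (i) there is a $\delta>0$ such that $\nu$ is supported by $(\delta,2\pi-\delta)$,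 i.e. the complement of this interval has $\nu$-measure zero; (ii) there are $D\in(1-\gamma,1)$ and $C<\infty$ such that $\nu(I)\le C|I|^D$ for every interval $I\subseteq(0,2\pi)$. Then, for $\nu$-almost every $\eta$, $$\sup\{R_n(\eta,\beta) : \beta\in[0,2\pi),\ n\in\mathbb Z_{+}\}<\infty,\qquad \mathbb Z_+=\{0,1,2,\dots\}.$$ -/

import Mathlib

namespace OPUC

noncomputable section

open Polynomial

/-- The Szegő dual of degree `n`, `P^*(z) = z ^ n * conj (P (1 / conj z))`: conjugate the
coefficients and reverse their order, `X ^ k ↦ X ^ (n - k)`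
(see `eval_szegoDual`). -/
def szegoDual (n : ℕ) (P : ℂ[X]) : ℂ[X] :=
  (P.map (starRingEnd ℂ)).reflect n

/-- The monic orthogonal polynomials `Φ_n` with Verblunsky coefficients `α`, generated from `Φ_0 = 1`
by the Szegő recurrence `Φ_{n+1}(z) = z Φ_n(z) - conj (α_n) Φ_n^*(z)`. -/
def monicPoly (α : ℕ → ℂ) : ℕ → ℂ[X]
  | 0 => 1
  | n + 1 => X * monicPoly α n
      - C (starRingEnd ℂ (α n)) * szegoDual n (monicPoly α n)

/-- `Φ_n(·, β)`: the monic polynomials with Verblunsky coefficients `e^{iβ} α_n`. -/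
def rotatedPoly (α : ℕ → ℂ) (β : ℝ) (n : ℕ) : ℂ[X] :=
  monicPoly (fun k => Complex.exp (Complex.I * β) * α k) n

/-- The Prüfer radius `R_n(η, β)`: the radius in the polar representation
`Φ_n(e^{iη}, β) = R_n(η, β) exp (i (n η + θ_n(η, β)))`
(see `pruferRadius_pos` and `eq_pruferRadius`). -/
def pruferRadius (α : ℕ → ℂ) (n : ℕ) (η β : ℝ) : ℝ :=
  ‖(rotatedPoly α β n).eval (Complex.exp (Complex.I * η))‖

/-- `ν` is uniformly `D`-Hölder continuous on `(0, 2π)`: there is a constant `K` with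
`ν(I) ≤ K |I| ^ D` for every interval `I ⊆ (0, 2π)`. -/
def UniformlyHolder (ν : MeasureTheory.Measure ℝ) (D : ℝ) : Prop :=
  ∃ K : NNReal, ∀ I : Set ℝ, I.OrdConnected → I ⊆ Set.Ioo 0 (2 * Real.pi) →
    ν I ≤ K * MeasureTheory.volume I ^ D

theorem natDegree_szegoDual_le (n : ℕ) (P : ℂ[X]) (h : P.natDegree ≤ n) :
    (szegoDual n P).natDegree ≤ n := by
  refine (natDegree_reflect_le).trans ?_
  exact max_le le_rfl ((natDegree_map_le).trans h)

theorem natDegree_monicPoly_le (α : ℕ → ℂ) (n : ℕ) : (monicPoly α n).natDegree ≤ n := by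
  induction n with
  | zero => simp [monicPoly]
  | succ n ih =>
    rw [monicPoly]
    refine (natDegree_sub_le _ _).trans (max_le ?_ ?_)
    · refine (natDegree_mul_le).trans ?_
      have := natDegree_X_le (R := ℂ)
      omega
    · refine (natDegree_C_mul_le _ _).trans ?_
      exact (natDegree_szegoDual_le n _ ih).trans n.le_succ

theorem eval_szegoDual (n : ℕ) (P : ℂ[X]) (h : P.natDegree ≤ n) (z : ℂ) (hz : z ≠ 0) :
    (szegoDual n P).eval z = z ^ n * starRingEnd ℂ (P.eval (1 / starRingEnd ℂ z)) := by
  have hz1 : z⁻¹ ≠ 0 := inv_ne_zero hz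
  letI : Invertible z⁻¹ := invertibleOfNonzero hz1
  have h1 := eval₂_reflect_mul_pow (RingHom.id ℂ) z⁻¹ n (P.map (starRingEnd ℂ))
    ((natDegree_map_le).trans h)
  rw [invOf_eq_inv, inv_inv] at h1
  have h2 : (P.map (starRingEnd ℂ)).eval z⁻¹
      = starRingEnd ℂ (P.eval (1 / starRingEnd ℂ z)) := by
    have h3 : z⁻¹ = starRingEnd ℂ (1 / starRingEnd ℂ z) := by simp
    rw [h3, eval_map_apply]
  rw [← h2]
  have h4 : (szegoDual n P).eval z * z⁻¹ ^ n = (P.map (starRingEnd ℂ)).eval z⁻¹ := h1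
  rw [← h4, inv_pow]
  field_simp

theorem monicPoly_eval_ne_zero (α : ℕ → ℂ) (hα : ∀ n, ‖α n‖ < 1) (z : ℂ) (hz : ‖z‖ = 1)
    (n : ℕ) : (monicPoly α n).eval z ≠ 0 := by
  induction n with
  | zero => simp [monicPoly]
  | succ n ih =>
    have hz0 : z ≠ 0 := by
      rintro rfl
      simp at hz
    have hzz : 1 / starRingEnd ℂ z = z := by
      rw [one_div, ← map_inv₀, Complex.inv_eq_conj hz, Complex.conj_conj]
    intro h0
    rw [monicPoly, eval_sub, eval_mul, eval_mul, eval_X, eval_C,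
      eval_szegoDual n _ (natDegree_monicPoly_le α n) z hz0, hzz, sub_eq_zero] at h0
    have h1 := congrArg norm h0
    simp only [norm_mul, norm_pow, hz, one_pow, one_mul, RCLike.norm_conj] at h1
    have h2 : 0 < ‖(monicPoly α n).eval z‖ := norm_pos_iff.mpr ih
    nlinarith [hα n]

theorem pruferRadius_pos (α : ℕ → ℂ) (hα : ∀ n, ‖α n‖ < 1) (n : ℕ) (η β : ℝ) :
    0 < pruferRadius α n η β := by
  refine norm_pos_iff.mpr (monicPoly_eval_ne_zero _ (fun k => ?_) _ ?_ n)
  · rw [norm_mul, mul_comm Complex.I, Complex.norm_exp_ofReal_mul_I, one_mul]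
    exact hα k
  · rw [mul_comm, Complex.norm_exp_ofReal_mul_I]

theorem eq_pruferRadius (α : ℕ → ℂ) (n : ℕ) (η β r θ : ℝ) (hr : 0 < r)
    (h : (rotatedPoly α β n).eval (Complex.exp (Complex.I * η))
      = r * Complex.exp (Complex.I * (n * η + θ))) :
    r = pruferRadius α n η β := by
  have h1 : ((n : ℂ) * η + θ) = ((n * η + θ : ℝ) : ℂ) := by push_cast; rfl
  rw [pruferRadius, h, norm_mul, h1, mul_comm Complex.I, Complex.norm_exp_ofReal_mul_I,
    mul_one, Complex.norm_real, Real.norm_of_nonneg hr.le]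

end

end OPUC

namespace OPUC

/-- The ordered product `(1 + A (a + n - 1)) * ⋯ * (1 + A a)`. -/
def transfer {R : Type*} [Ring R] (A : ℕ → R) (a : ℕ) : ℕ → R
  | 0 => 1
  | n + 1 => (1 + A (a + n)) * transfer A a n

/-- The sum of the `n` consecutive terms `A a, …, A (a + n - 1)`. -/
def windowSum {E : Type*} [AddCommMonoid E] (A : ℕ → E) (a n : ℕ) : E :=
  ∑ i ∈ Finset.range n, A (a + i)

/-- The sum of `‖∑ i ∈ J, A i‖ ^ 2` over all dyadic subintervals `J` of `[a, a + 2 ^ d)`. -/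
def dyadicEnergy {E : Type*} [SeminormedAddCommGroup E] (A : ℕ → E) : ℕ → ℕ → ℝ
  | 0, a => ‖windowSum A a 1‖ ^ 2
  | d + 1, a => ‖windowSum A a (2 ^ (d + 1))‖ ^ 2
      + (dyadicEnergy A d a + dyadicEnergy A d (a + 2 ^ d))

theorem windowSum_add {E : Type*} [AddCommMonoid E] (A : ℕ → E) (a m n : ℕ) :
    windowSum A a (m + n) = windowSum A a m + windowSum A (a + m) n := by
  simp only [windowSum, Finset.sum_range_add, add_assoc]

theorem transfer_add {R : Type*} [Ring R] (A : ℕ → R) (a m n : ℕ) :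
    transfer A a (m + n) = transfer A (a + m) n * transfer A a m := by
  induction n with
  | zero => simp [transfer]
  | succ n ih => rw [← add_assoc, transfer, transfer, ih, mul_assoc, add_assoc]

section Energy

variable {E F : Type*} [SeminormedAddCommGroup E] [SeminormedAddCommGroup F]

theorem sq_norm_windowSum_le_dyadicEnergy (A : ℕ → E) (d a : ℕ) :
    ‖windowSum A a (2 ^ d)‖ ^ 2 ≤ dyadicEnergy A d a := by
  induction d generalizing a with
  | zero => simp [dyadicEnergy]
  | succ d ih =>
    have h1 := (sq_nonneg _).trans (ih a)
    have h2 := (sq_nonneg _).trans (ih (a + 2 ^ d))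
    rw [dyadicEnergy]
    linarith

theorem dyadicEnergy_nonneg (A : ℕ → E) (d a : ℕ) : 0 ≤ dyadicEnergy A d a :=
  (sq_nonneg _).trans (sq_norm_windowSum_le_dyadicEnergy A d a)

theorem dyadicEnergy_left_le (A : ℕ → E) (d a : ℕ) :
    dyadicEnergy A d a ≤ dyadicEnergy A (d + 1) a := by
  rw [dyadicEnergy]
  linarith [sq_nonneg ‖windowSum A a (2 ^ (d + 1))‖, dyadicEnergy_nonneg A d (a + 2 ^ d)]

theorem dyadicEnergy_right_le (A : ℕ → E) (d a : ℕ) :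
    dyadicEnergy A d (a + 2 ^ d) ≤ dyadicEnergy A (d + 1) a := by
  rw [dyadicEnergy]
  linarith [sq_nonneg ‖windowSum A a (2 ^ (d + 1))‖, dyadicEnergy_nonneg A d a]

theorem dyadicEnergy_congr {A : ℕ → E} {B : ℕ → F}
    (h : ∀ a n, ‖windowSum A a n‖ = ‖windowSum B a n‖) (d a : ℕ) :
    dyadicEnergy A d a = dyadicEnergy B d a := by
  induction d generalizing a with
  | zero => simp [dyadicEnergy, h]
  | succ d ih => simp [dyadicEnergy, h, ih]

end Energy

section Transfer

variable {R : Type*} [NormedRing R]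

/-- The quadratic error in replacing an ordered product by its linearization is controlled by the
dyadic energy. -/
theorem norm_transfer_sub_one_sub_windowSum_le (A : ℕ → R) {h : ℝ} {N : ℕ} (h0 : 0 ≤ h)
    (hN : (1 + 3 * h) ^ N ≤ 3) (d a : ℕ) (hd : d ≤ N) (hA : dyadicEnergy A d a ≤ h) :
    ‖transfer A a (2 ^ d) - 1 - windowSum A a (2 ^ d)‖
      ≤ (1 + 3 * h) ^ d * (dyadicEnergy A d a - ‖windowSum A a (2 ^ d)‖ ^ 2) := by
  induction d generalizing a with
  | zero => simp [transfer, windowSum, dyadicEnergy]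
  | succ d ih =>
    have hd' : d ≤ N := by omega
    have hl := (dyadicEnergy_left_le A d a).trans hA
    have hr := (dyadicEnergy_right_le A d a).trans hA
    have il := ih a hd' hl
    have ir := ih (a + 2 ^ d) hd' hr
    have sl := sq_norm_windowSum_le_dyadicEnergy A d a
    have sr := sq_norm_windowSum_le_dyadicEnergy A d (a + 2 ^ d)
    have hpow : (1 + 3 * h) ^ d ≤ 3 :=
      (pow_le_pow_right₀ (by linarith) hd').trans hN
    have hpow1 : 1 ≤ (1 + 3 * h) ^ d := one_le_pow₀ (by linarith)
    have e1 : dyadicEnergy A (d + 1) a - ‖windowSum A a (2 ^ (d + 1))‖ ^ 2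
        = dyadicEnergy A d a + dyadicEnergy A d (a + 2 ^ d) := by
      rw [dyadicEnergy]; ring
    rw [e1]
    have e2 : 2 ^ (d + 1) = 2 ^ d + 2 ^ d := by ring
    rw [e2, transfer_add, windowSum_add]
    set Sl := windowSum A a (2 ^ d)
    set Sr := windowSum A (a + 2 ^ d) (2 ^ d)
    set Tl := transfer A a (2 ^ d)
    set Tr := transfer A (a + 2 ^ d) (2 ^ d)
    set El := dyadicEnergy A d a
    set Er := dyadicEnergy A d (a + 2 ^ d)
    set p := (1 + 3 * h) ^ d with hp
    have key : Tr * Tl - 1 - (Sl + Sr) = (Tl - 1 - Sl) + (Tr - 1 - Sr)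
        + (Sr + (Tr - 1 - Sr)) * (Sl + (Tl - 1 - Sl)) := by noncomm_ring
    have hbound : ‖Tr * Tl - 1 - (Sl + Sr)‖ ≤ ‖Tl - 1 - Sl‖ + ‖Tr - 1 - Sr‖
        + (‖Sr‖ + ‖Tr - 1 - Sr‖) * (‖Sl‖ + ‖Tl - 1 - Sl‖) := by
      rw [key]
      refine (norm_add₃_le).trans ?_
      gcongr
      refine (norm_mul_le _ _).trans ?_
      gcongr <;> exact norm_add_le _ _
    have ql0 := norm_nonneg (Tl - 1 - Sl)
    have qr0 := norm_nonneg (Tr - 1 - Sr)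
    have sl0 := norm_nonneg Sl
    have sr0 := norm_nonneg Sr
    set ql := ‖Tl - 1 - Sl‖
    set qr := ‖Tr - 1 - Sr‖
    have ql3 : ql ≤ 3 * h := il.trans (mul_le_mul hpow (by nlinarith) (by linarith) (by norm_num))
    have qr3 : qr ≤ 3 * h := ir.trans (mul_le_mul hpow (by nlinarith) (by linarith) (by norm_num))
    have b1 : (‖Sr‖ + qr) * (‖Sl‖ + ql) ≤ ‖Sl‖ ^ 2 + ‖Sr‖ ^ 2 + ql ^ 2 + qr ^ 2 := by
      nlinarith [sq_nonneg (‖Sr‖ + qr - (‖Sl‖ + ql)), sq_nonneg (‖Sr‖ - qr),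
        sq_nonneg (‖Sl‖ - ql)]
    have b2 : ql ^ 2 ≤ 3 * h * ql := by nlinarith
    have b3 : qr ^ 2 ≤ 3 * h * qr := by nlinarith
    have hp1 : (1 + 3 * h) ^ (d + 1) = (1 + 3 * h) * p := by rw [pow_succ, mul_comm]
    have hp2 : 1 ≤ (1 + 3 * h) * p := by nlinarith
    rw [hp1]
    have b4 : (1 + 3 * h) * ql ≤ (1 + 3 * h) * (p * (El - ‖Sl‖ ^ 2)) := by gcongr
    have b5 : (1 + 3 * h) * qr ≤ (1 + 3 * h) * (p * (Er - ‖Sr‖ ^ 2)) := by gcongr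
    have b6 : ‖Sl‖ ^ 2 ≤ (1 + 3 * h) * p * ‖Sl‖ ^ 2 := le_mul_of_one_le_left (sq_nonneg _) hp2
    have b7 : ‖Sr‖ ^ 2 ≤ (1 + 3 * h) * p * ‖Sr‖ ^ 2 := le_mul_of_one_le_left (sq_nonneg _) hp2
    nlinarith

theorem norm_transfer_two_pow_le [NormOneClass R] (A : ℕ → R) {h : ℝ} {N : ℕ} (h0 : 0 ≤ h)
    (h1 : h ≤ 1) (hN : (1 + 3 * h) ^ N ≤ 3) (d a : ℕ) (hd : d ≤ N)
    (hA : dyadicEnergy A d a ≤ h) :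
    ‖transfer A a (2 ^ d)‖ ≤ 1 + 4 * √h := by
  have hq := norm_transfer_sub_one_sub_windowSum_le A h0 hN d a hd hA
  have hs := (sq_norm_windowSum_le_dyadicEnergy A d a).trans hA
  have hs' : ‖windowSum A a (2 ^ d)‖ ≤ √h := Real.le_sqrt_of_sq_le hs
  have hpow : (1 + 3 * h) ^ d ≤ 3 := (pow_le_pow_right₀ (by linarith) hd).trans hN
  have hq' : (1 + 3 * h) ^ d * (dyadicEnergy A d a - ‖windowSum A a (2 ^ d)‖ ^ 2) ≤ 3 * h :=
    mul_le_mul hpow (by linarith [sq_nonneg ‖windowSum A a (2 ^ d)‖])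
      (by linarith [sq_norm_windowSum_le_dyadicEnergy A d a]) (by norm_num)
  have hh : h ≤ √h := Real.le_sqrt_of_sq_le (by nlinarith)
  calc ‖transfer A a (2 ^ d)‖
      = ‖1 + windowSum A a (2 ^ d) + (transfer A a (2 ^ d) - 1 - windowSum A a (2 ^ d))‖ := by
        congr 1; abel
    _ ≤ ‖(1 : R)‖ + ‖windowSum A a (2 ^ d)‖
        + ‖transfer A a (2 ^ d) - 1 - windowSum A a (2 ^ d)‖ := norm_add₃_le
    _ ≤ 1 + 4 * √h := by rw [norm_one]; linarith

theorem norm_transfer_le_of_le_two_pow [NormOneClass R] (A : ℕ → R) {h : ℝ} {N : ℕ} (h0 : 0 ≤ h)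
    (h1 : h ≤ 1) (hN : (1 + 3 * h) ^ N ≤ 3) (d a n : ℕ) (hd : d ≤ N) (hn : n ≤ 2 ^ d)
    (hA : dyadicEnergy A d a ≤ h) :
    ‖transfer A a n‖ ≤ (1 + 4 * √h) ^ (d + 1) := by
  have hs : 1 ≤ 1 + 4 * √h := by linarith [Real.sqrt_nonneg h]
  induction d generalizing a n with
  | zero =>
    have hn' : n = 0 ∨ n = 2 ^ 0 := by simp only [pow_zero] at hn ⊢; omega
    rcases hn' with rfl | rfl
    · simp [transfer]
    · simpa using norm_transfer_two_pow_le A h0 h1 hN 0 a hd hA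
  | succ d ih =>
    have hl := (dyadicEnergy_left_le A d a).trans hA
    have hr := (dyadicEnergy_right_le A d a).trans hA
    have hd' : d ≤ N := by omega
    rcases le_total n (2 ^ d) with hnd | hnd
    · exact (ih a n hd' hnd hl).trans (pow_le_pow_right₀ hs (by omega))
    · obtain ⟨m, rfl⟩ := Nat.exists_eq_add_of_le hnd
      rw [transfer_add, pow_succ]
      refine (norm_mul_le _ _).trans (mul_le_mul (ih _ m hd' ?_ hr)
        (norm_transfer_two_pow_le A h0 h1 hN d a hd' hl) (norm_nonneg _) (by positivity))
      rw [pow_succ] at hn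
      omega

end Transfer

end OPUC

namespace OPUC
open MeasureTheory

/-- One-dimensional Sobolev inequality on an interval. -/
theorem le_average_add_integral_abs_deriv {g g' : ℝ → ℝ} {a b x : ℝ} (hab : a < b)
    (hg : ∀ t, HasDerivAt g (g' t) t) (hg' : Continuous g') (hx : x ∈ Set.Icc a b) :
    g x ≤ (b - a)⁻¹ * (∫ t in a..b, g t) + ∫ t in a..b, |g' t| := by
  have hgc : Continuous g := continuous_iff_continuousAt.2 fun t => (hg t).continuousAt
  have hpt : ∀ y ∈ Set.Icc a b, g x - (∫ t in a..b, |g' t|) ≤ g y := by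
    intro y hy
    have h1 : ∫ t in y..x, g' t = g x - g y :=
      intervalIntegral.integral_eq_sub_of_hasDerivAt (fun t _ => hg t)
        (hg'.intervalIntegrable _ _)
    have h2 : |∫ t in y..x, g' t| ≤ |(∫ t in y..x, |g' t|)| := by
      simpa only [Real.norm_eq_abs] using intervalIntegral.norm_integral_le_abs_integral_norm
        (f := g') (a := y) (b := x) (μ := volume)
    have h3 : |(∫ t in y..x, |g' t|)| ≤ |(∫ t in a..b, |g' t|)| := by
      refine intervalIntegral.abs_integral_mono_interval ?_ (ae_of_all _ fun t => abs_nonneg _)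
        (hg'.abs.intervalIntegrable _ _)
      rw [Set.uIoc_of_le hab.le]
      exact Set.Ioc_subset_Ioc (le_min hy.1 hx.1) (max_le hy.2 hx.2)
    have h4 : 0 ≤ ∫ t in a..b, |g' t| :=
      intervalIntegral.integral_nonneg hab.le fun t _ => abs_nonneg _
    rw [abs_of_nonneg h4] at h3
    have := (le_abs_self _).trans (h2.trans h3)
    linarith
  have hint := intervalIntegral.integral_mono_on hab.le
    (intervalIntegrable_const (μ := volume)) (hgc.intervalIntegrable a b) hpt
  rw [intervalIntegral.integral_const, smul_eq_mul] at hint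
  have hba : 0 < b - a := sub_pos.2 hab
  have := (le_inv_mul_iff₀ hba).2 hint
  linarith

theorem integral_exp_int_mul (m : ℤ) :
    ∫ x in (0 : ℝ)..2 * Real.pi, Complex.exp (Complex.I * m * x)
      = if m = 0 then 2 * Real.pi else 0 := by
  split_ifs with h
  · simp [h]
  · rw [integral_exp_mul_complex (by simp [h])]
    have : Complex.exp (Complex.I * m * ((2 * Real.pi : ℝ) : ℂ)) = 1 := by
      rw [Complex.exp_eq_one_iff]
      exact ⟨m, by push_cast; ring⟩
    rw [this]
    simp

/-- The trigonometric polynomial `∑_{k < L} c_k e^{ikx}`. -/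
noncomputable def trigPoly (c : ℕ → ℂ) (L : ℕ) (x : ℝ) : ℂ :=
  ∑ k ∈ Finset.range L, c k * Complex.exp (Complex.I * k * x)

theorem continuous_trigPoly (c : ℕ → ℂ) (L : ℕ) : Continuous (trigPoly c L) := by
  unfold trigPoly
  fun_prop

theorem integral_sq_norm_trigPoly (c : ℕ → ℂ) (L : ℕ) :
    ∫ x in (0 : ℝ)..2 * Real.pi, ‖trigPoly c L x‖ ^ 2
      = 2 * Real.pi * ∑ k ∈ Finset.range L, ‖c k‖ ^ 2 := by
  have hexp : ∀ x : ℝ, ((‖trigPoly c L x‖ ^ 2 : ℝ) : ℂ)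
      = ∑ k ∈ Finset.range L, ∑ l ∈ Finset.range L, c k * starRingEnd ℂ (c l)
        * Complex.exp (Complex.I * ((k - l : ℤ) : ℂ) * x) := by
    intro x
    push_cast
    rw [← Complex.mul_conj', trigPoly, map_sum, Finset.sum_mul_sum]
    refine Finset.sum_congr rfl fun k _ => Finset.sum_congr rfl fun l _ => ?_
    rw [map_mul, ← Complex.exp_conj]
    have : Complex.exp (Complex.I * ((k : ℂ) - (l : ℂ)) * x) = Complex.exp (Complex.I * k * x)
        * Complex.exp (starRingEnd ℂ (Complex.I * l * x)) := by
      rw [← Complex.exp_add]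
      congr 1
      simp
      ring
    rw [this]
    ring
  apply Complex.ofReal_injective
  rw [← intervalIntegral.integral_ofReal]
  simp_rw [hexp]
  rw [intervalIntegral.integral_finsetSum
    (fun k _ => Continuous.intervalIntegrable (by fun_prop) _ _)]
  have hin : ∀ k ∈ Finset.range L, (∫ x in (0 : ℝ)..2 * Real.pi,
      ∑ l ∈ Finset.range L, c k * starRingEnd ℂ (c l)
        * Complex.exp (Complex.I * ((k - l : ℤ) : ℂ) * x)) = 2 * Real.pi * (‖c k‖ : ℂ) ^ 2 := by
    intro k hk
    rw [intervalIntegral.integral_finsetSum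
      (fun k _ => Continuous.intervalIntegrable (by fun_prop) _ _)]
    simp_rw [intervalIntegral.integral_const_mul, integral_exp_int_mul]
    rw [Finset.sum_eq_single k]
    · simp [Complex.mul_conj']
      ring
    · intro l _ hl
      have : (k : ℤ) - l ≠ 0 := by omega
      simp [this]
    · exact fun h => absurd hk h
  rw [Finset.sum_congr rfl hin, ← Finset.mul_sum]
  push_cast
  rfl

theorem hasDerivAt_trigPoly (c : ℕ → ℂ) (L : ℕ) (x : ℝ) :
    HasDerivAt (trigPoly c L) (trigPoly (fun k => Complex.I * k * c k) L x) x := by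
  unfold trigPoly
  refine HasDerivAt.fun_sum fun k _ => ?_
  have h1 : HasDerivAt (fun y : ℝ => Complex.I * k * (y : ℂ)) (Complex.I * k) x := by
    simpa using (Complex.ofRealCLM.hasDerivAt (x := x)).const_mul (Complex.I * (k : ℂ))
  exact (h1.cexp.const_mul (c k)).congr_deriv (by ring)

theorem integral_abs_deriv_sq_norm_trigPoly_le (c : ℕ → ℂ) {L : ℕ} (hL : 0 < L) :
    ∫ x in (0 : ℝ)..2 * Real.pi,
      |2 * inner ℝ (trigPoly c L x) (trigPoly (fun k => Complex.I * k * c k) L x)|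
      ≤ 4 * Real.pi * L * ∑ k ∈ Finset.range L, ‖c k‖ ^ 2 := by
  have hL' : (0 : ℝ) < L := Nat.cast_pos.2 hL
  set c' : ℕ → ℂ := fun k => Complex.I * k * c k with hc'
  have hc := continuous_trigPoly c L
  have hcd := continuous_trigPoly c' L
  have hle : ∀ x : ℝ, |2 * inner ℝ (trigPoly c L x) (trigPoly c' L x)|
      ≤ L * ‖trigPoly c L x‖ ^ 2 + (L : ℝ)⁻¹ * ‖trigPoly c' L x‖ ^ 2 := by
    intro x
    rw [abs_mul, abs_two]
    have h1 := abs_real_inner_le_norm (trigPoly c L x) (trigPoly c' L x)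
    have h2 : 0 ≤ (L : ℝ)⁻¹ * (L * ‖trigPoly c L x‖ - ‖trigPoly c' L x‖) ^ 2 := by positivity
    have h3 : (L : ℝ)⁻¹ * (L * ‖trigPoly c L x‖ - ‖trigPoly c' L x‖) ^ 2
        = L * ‖trigPoly c L x‖ ^ 2 + (L : ℝ)⁻¹ * ‖trigPoly c' L x‖ ^ 2
          - 2 * (‖trigPoly c L x‖ * ‖trigPoly c' L x‖) := by
      field_simp
      ring
    linarith
  have hpi := Real.pi_pos
  refine (intervalIntegral.integral_mono_on (by positivity)
    (Continuous.intervalIntegrable (by fun_prop) _ _)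
    (Continuous.intervalIntegrable (by fun_prop) _ _) fun x _ => hle x).trans ?_
  rw [intervalIntegral.integral_add (Continuous.intervalIntegrable (by fun_prop) _ _)
    (Continuous.intervalIntegrable (by fun_prop) _ _), intervalIntegral.integral_const_mul,
    intervalIntegral.integral_const_mul, integral_sq_norm_trigPoly, integral_sq_norm_trigPoly]
  have hsum : ∑ k ∈ Finset.range L, ‖c' k‖ ^ 2 ≤ L ^ 2 * ∑ k ∈ Finset.range L, ‖c k‖ ^ 2 := by
    rw [Finset.mul_sum]
    refine Finset.sum_le_sum fun k hk => ?_
    have hk' : (k : ℝ) ≤ L := Nat.cast_le.2 (Finset.mem_range.1 hk).le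
    simp only [hc', norm_mul, Complex.norm_I, one_mul, Complex.norm_natCast, mul_pow]
    gcongr
  have : (L : ℝ)⁻¹ * (2 * Real.pi * ∑ k ∈ Finset.range L, ‖c' k‖ ^ 2)
      ≤ (L : ℝ)⁻¹ * (2 * Real.pi * (L ^ 2 * ∑ k ∈ Finset.range L, ‖c k‖ ^ 2)) := by gcongr
  refine (add_le_add_right this _).trans (le_of_eq ?_)
  field_simp
  ring

end OPUC

namespace OPUC
open MeasureTheory

/-- Square functions of trigonometric polynomials of length `L` with respect to a uniformly
`D`-Hölder measure lose at most a factor `L ^ (1 - D)`. -/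
theorem lintegral_sq_norm_trigPoly_le {ν : Measure ℝ}
    (hsupp : ∀ᵐ x ∂ν, x ∈ Set.Ioo 0 (2 * Real.pi)) {D : ℝ} (hD : 0 ≤ D) {K : NNReal}
    (hK : ∀ I : Set ℝ, I.OrdConnected → I ⊆ Set.Ioo 0 (2 * Real.pi) → ν I ≤ K * volume I ^ D)
    (c : ℕ → ℂ) {L : ℕ} (hL : 0 < L) :
    ∫⁻ x, ENNReal.ofReal (‖trigPoly c L x‖ ^ 2) ∂ν
      ≤ ENNReal.ofReal (K * (2 * Real.pi) ^ D * (1 + 4 * Real.pi) * (L : ℝ) ^ (1 - D)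
        * ∑ k ∈ Finset.range L, ‖c k‖ ^ 2) := by
  have hpi := Real.pi_pos
  have hL' : (0 : ℝ) < L := Nat.cast_pos.2 hL
  set ℓ : ℝ := 2 * Real.pi / L with hℓ
  have hℓ0 : 0 < ℓ := by positivity
  set g : ℝ → ℝ := fun x => ‖trigPoly c L x‖ ^ 2 with hg
  set g' : ℝ → ℝ := fun x =>
    2 * inner ℝ (trigPoly c L x) (trigPoly (fun k => Complex.I * k * c k) L x) with hg'
  have hgc : Continuous g := by
    have := continuous_trigPoly c L
    fun_prop
  have hgc' : Continuous g' := by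
    have := continuous_trigPoly c L
    have := continuous_trigPoly (fun k => Complex.I * k * c k) L
    fun_prop
  have hder : ∀ t, HasDerivAt g (g' t) t := fun t => (hasDerivAt_trigPoly c L t).norm_sq
  let J : ℕ → Set ℝ := fun j => Set.Icc (ℓ * j) (ℓ * (j + 1 : ℕ)) ∩ Set.Ioo 0 (2 * Real.pi)
  let M : ℕ → ℝ := fun j => ℓ⁻¹ * (∫ t in (ℓ * j)..(ℓ * (j + 1 : ℕ)), g t)
    + ∫ t in (ℓ * j)..(ℓ * (j + 1 : ℕ)), |g' t|
  have hstep : ∀ j : ℕ, ℓ * (j + 1 : ℕ) - ℓ * j = ℓ := fun j => by push_cast; ring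
  have hlt : ∀ j : ℕ, ℓ * j < ℓ * (j + 1 : ℕ) := fun j => by linarith [hstep j]
  have hM : ∀ j, ∀ x ∈ J j, g x ≤ M j := by
    intro j x hx
    have := le_average_add_integral_abs_deriv (hlt j) hder hgc' hx.1
    rwa [hstep] at this
  have hM0 : ∀ j, 0 ≤ M j := fun j => add_nonneg
    (mul_nonneg (by positivity) (intervalIntegral.integral_nonneg (hlt j).le
      fun t _ => sq_nonneg _))
    (intervalIntegral.integral_nonneg (hlt j).le fun t _ => abs_nonneg _)
  have hJν : ∀ j, ν (J j) ≤ ENNReal.ofReal (K * ℓ ^ D) := by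
    intro j
    refine (hK (J j) (Set.ordConnected_Icc.inter Set.ordConnected_Ioo)
      Set.inter_subset_right).trans ?_
    have hv : volume (J j) ≤ ENNReal.ofReal ℓ := by
      refine (measure_mono Set.inter_subset_left).trans ?_
      rw [Real.volume_Icc, hstep]
    rw [ENNReal.ofReal_mul K.coe_nonneg, ENNReal.ofReal_coe_nnreal,
      ← ENNReal.ofReal_rpow_of_nonneg hℓ0.le hD]
    gcongr
  have hcover : Set.Ioo 0 (2 * Real.pi) ⊆ ⋃ j : Fin L, J j := by
    intro x hx
    have hx0 : 0 ≤ x / ℓ := div_nonneg hx.1.le hℓ0.le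
    have h1 : (⌊x / ℓ⌋₊ : ℝ) ≤ x / ℓ := Nat.floor_le hx0
    have h2 : x / ℓ < ⌊x / ℓ⌋₊ + 1 := Nat.lt_floor_add_one _
    have h3 : ⌊x / ℓ⌋₊ < L := by
      rw [Nat.floor_lt hx0, div_lt_iff₀ hℓ0, hℓ, mul_div_cancel₀ _ hL'.ne']
      exact hx.2
    refine Set.mem_iUnion.2 ⟨⟨_, h3⟩, ⟨?_, ?_⟩, hx⟩
    · rwa [le_div_iff₀ hℓ0, mul_comm] at h1
    · rw [div_lt_iff₀ hℓ0, mul_comm] at h2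
      push_cast
      exact h2.le
  have hpiece : ∀ j, ∫⁻ x in J j, ENNReal.ofReal (g x) ∂ν
      ≤ ENNReal.ofReal (K * ℓ ^ D * M j) := by
    intro j
    calc ∫⁻ x in J j, ENNReal.ofReal (g x) ∂ν
        ≤ ∫⁻ _ in J j, ENNReal.ofReal (M j) ∂ν :=
          setLIntegral_mono measurable_const fun x hx => ENNReal.ofReal_le_ofReal (hM j x hx)
      _ = ENNReal.ofReal (M j) * ν (J j) := setLIntegral_const _ _
      _ ≤ ENNReal.ofReal (M j) * ENNReal.ofReal (K * ℓ ^ D) := by gcongr; exact hJν j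
      _ = ENNReal.ofReal (K * ℓ ^ D * M j) := by rw [← ENNReal.ofReal_mul (hM0 j), mul_comm]
  have hsumM : ∑ j ∈ Finset.range L, M j
      ≤ (1 + 4 * Real.pi) * L * ∑ k ∈ Finset.range L, ‖c k‖ ^ 2 := by
    have hend : ℓ * (L : ℝ) = 2 * Real.pi := div_mul_cancel₀ _ hL'.ne'
    have s1 : ∑ j ∈ Finset.range L, ∫ t in (ℓ * j)..(ℓ * (j + 1 : ℕ)), g t
        = ∫ t in (0 : ℝ)..2 * Real.pi, g t := by
      rw [intervalIntegral.sum_integral_adjacent_intervals (a := fun j : ℕ => ℓ * (j : ℝ))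
        (fun j _ => hgc.intervalIntegrable _ _)]
      simp [hend]
    have s2 : ∑ j ∈ Finset.range L, ∫ t in (ℓ * j)..(ℓ * (j + 1 : ℕ)), |g' t|
        = ∫ t in (0 : ℝ)..2 * Real.pi, |g' t| := by
      rw [intervalIntegral.sum_integral_adjacent_intervals (a := fun j : ℕ => ℓ * (j : ℝ))
        (fun j _ => hgc'.abs.intervalIntegrable _ _)]
      simp [hend]
    have s3 := integral_abs_deriv_sq_norm_trigPoly_le c hL
    rw [Finset.sum_add_distrib, ← Finset.mul_sum, s1, s2, integral_sq_norm_trigPoly]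
    have s4 : ℓ⁻¹ * (2 * Real.pi * ∑ k ∈ Finset.range L, ‖c k‖ ^ 2)
        = L * ∑ k ∈ Finset.range L, ‖c k‖ ^ 2 := by
      rw [hℓ]
      field_simp
    rw [s4]
    linarith
  calc ∫⁻ x, ENNReal.ofReal (g x) ∂ν
      = ∫⁻ x in Set.Ioo 0 (2 * Real.pi), ENNReal.ofReal (g x) ∂ν := by
        rw [Measure.restrict_eq_self_of_ae_mem hsupp]
    _ ≤ ∫⁻ x in ⋃ j : Fin L, J j, ENNReal.ofReal (g x) ∂ν := lintegral_mono_set hcover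
    _ ≤ ∑' j : Fin L, ∫⁻ x in J j, ENNReal.ofReal (g x) ∂ν := lintegral_iUnion_le _ _
    _ ≤ ∑ j : Fin L, ENNReal.ofReal (K * ℓ ^ D * M j) := by
        rw [tsum_fintype]
        exact Finset.sum_le_sum fun j _ => hpiece j
    _ = ENNReal.ofReal (K * ℓ ^ D * ∑ j ∈ Finset.range L, M j) := by
        rw [Finset.sum_range, Finset.mul_sum, ENNReal.ofReal_sum_of_nonneg]
        exact fun j _ => mul_nonneg (by positivity) (hM0 j)
    _ ≤ _ := by
        refine ENNReal.ofReal_le_ofReal ((mul_le_mul_of_nonneg_left hsumM (by positivity)).trans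
          (le_of_eq ?_))
        rw [hℓ, Real.div_rpow (by positivity) hL'.le, Real.rpow_sub hL', Real.rpow_one]
        field_simp

/-- The sequence `α_n e^{inη}`. -/
noncomputable def modulated (α : ℕ → ℂ) (η : ℝ) (n : ℕ) : ℂ :=
  α n * Complex.exp (Complex.I * n * η)

theorem norm_windowSum_modulated (α : ℕ → ℂ) (η : ℝ) (a L : ℕ) :
    ‖windowSum (modulated α η) a L‖ = ‖trigPoly (fun k => α (a + k)) L η‖ := by
  have h : windowSum (modulated α η) a L
      = Complex.exp (Complex.I * a * η) * trigPoly (fun k => α (a + k)) L η := by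
    rw [windowSum, trigPoly, Finset.mul_sum]
    refine Finset.sum_congr rfl fun k _ => ?_
    rw [modulated, mul_left_comm, ← Complex.exp_add]
    congr 2
    push_cast
    ring
  have h1 : ‖Complex.exp (Complex.I * a * η)‖ = 1 := by
    simp [Complex.norm_exp]
  rw [h, norm_mul, h1, one_mul]

theorem continuous_dyadicEnergy_modulated (α : ℕ → ℂ) (d a : ℕ) :
    Continuous fun η => dyadicEnergy (modulated α η) d a := by
  induction d generalizing a with
  | zero =>
    simp only [dyadicEnergy, norm_windowSum_modulated]
    exact (continuous_trigPoly _ _).norm.pow 2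
  | succ d ih =>
    simp only [dyadicEnergy, norm_windowSum_modulated]
    exact ((continuous_trigPoly _ _).norm.pow 2).add ((ih a).add (ih _))

theorem lintegral_dyadicEnergy_modulated_le {ν : Measure ℝ} {B : ℝ} (hB : 0 ≤ B) {k : ℕ}
    (hν : ∀ (c : ℕ → ℂ) (d : ℕ), d ≤ k → ∫⁻ x, ENNReal.ofReal (‖trigPoly c (2 ^ d) x‖ ^ 2) ∂ν
      ≤ ENNReal.ofReal (B * ∑ i ∈ Finset.range (2 ^ d), ‖c i‖ ^ 2))
    (α : ℕ → ℂ) (d a : ℕ) (hd : d ≤ k) :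
    ∫⁻ η, ENNReal.ofReal (dyadicEnergy (modulated α η) d a) ∂ν
      ≤ ENNReal.ofReal ((d + 1) * (B * windowSum (fun n => ‖α n‖ ^ 2) a (2 ^ d))) := by
  have hw : ∀ a n, 0 ≤ windowSum (fun n => ‖α n‖ ^ 2) a n :=
    fun a n => Finset.sum_nonneg fun i _ => sq_nonneg _
  have hS : ∀ d a, d ≤ k → ∫⁻ η, ENNReal.ofReal (‖windowSum (modulated α η) a (2 ^ d)‖ ^ 2) ∂ν
      ≤ ENNReal.ofReal (B * windowSum (fun n => ‖α n‖ ^ 2) a (2 ^ d)) := by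
    intro d a hd
    simp only [norm_windowSum_modulated]
    exact hν _ d hd
  induction d generalizing a with
  | zero => simpa [dyadicEnergy] using hS 0 a hd
  | succ d ih =>
    have hm : ∀ a, Measurable fun η => ENNReal.ofReal (dyadicEnergy (modulated α η) d a) :=
      fun a => (continuous_dyadicEnergy_modulated α d a).measurable.ennreal_ofReal
    have hm' : Measurable fun η =>
        ENNReal.ofReal (‖windowSum (modulated α η) a (2 ^ (d + 1))‖ ^ 2) := by
      simp only [norm_windowSum_modulated]
      exact ((continuous_trigPoly _ _).norm.pow 2).measurable.ennreal_ofReal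
    have e : ∀ η, ENNReal.ofReal (dyadicEnergy (modulated α η) (d + 1) a)
        = ENNReal.ofReal (‖windowSum (modulated α η) a (2 ^ (d + 1))‖ ^ 2)
          + (ENNReal.ofReal (dyadicEnergy (modulated α η) d a)
            + ENNReal.ofReal (dyadicEnergy (modulated α η) d (a + 2 ^ d))) := by
      intro η
      rw [dyadicEnergy, ENNReal.ofReal_add (sq_nonneg _) (add_nonneg (dyadicEnergy_nonneg _ _ _)
        (dyadicEnergy_nonneg _ _ _)), ENNReal.ofReal_add (dyadicEnergy_nonneg _ _ _)
        (dyadicEnergy_nonneg _ _ _)]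
    simp only [e]
    rw [lintegral_add_left hm', lintegral_add_left (hm a)]
    refine (add_le_add (hS (d + 1) a hd)
      (add_le_add (ih a (by omega)) (ih (a + 2 ^ d) (by omega)))).trans ?_
    have p1 := hw a (2 ^ d)
    have p2 := hw (a + 2 ^ d) (2 ^ d)
    have p3 := hw a (2 ^ (d + 1))
    rw [← ENNReal.ofReal_add (by positivity) (by positivity),
      ← ENNReal.ofReal_add (by positivity) (by positivity)]
    refine ENNReal.ofReal_le_ofReal (le_of_eq ?_)
    have e2 : 2 ^ (d + 1) = 2 ^ d + 2 ^ d := by ring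
    rw [e2, windowSum_add]
    push_cast
    ring

/-- Geometrically small integrals give almost everywhere geometric decay. -/
theorem ae_exists_le_geometric {X : Type*} [MeasurableSpace X] {μ : Measure X} {f : ℕ → X → ℝ}
    (hf : ∀ k, Measurable (f k)) {C q : ℝ} (hq0 : 0 < q) (hq1 : q < 1)
    (hint : ∀ k : ℕ, ∫⁻ x, ENNReal.ofReal (f k x) ∂μ ≤ ENNReal.ofReal (C * ((k + 1) * (q ^ 2) ^ k))) :
    ∀ᵐ x ∂μ, ∃ K : ℝ, 0 ≤ K ∧ ∀ k, f k x ≤ K * q ^ k := by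
  let F : ℕ → X → ENNReal := fun k x => ENNReal.ofReal ((q ^ k)⁻¹) * ENNReal.ofReal (f k x)
  have hF : ∀ k, Measurable (F k) := fun k => (hf k).ennreal_ofReal.const_mul _
  have hsum : Summable fun k : ℕ => C * ((k + 1) * q ^ k) := by
    have h1 := summable_pow_mul_geometric_of_norm_lt_one 1 (r := q)
      (by rwa [Real.norm_of_nonneg hq0.le])
    have h2 := summable_geometric_of_lt_one hq0.le hq1
    refine ((h1.add h2).mul_left C).congr fun k => ?_
    simp only [pow_one]
    ring
  have hle : ∀ k, ∫⁻ x, F k x ∂μ ≤ ENNReal.ofReal (C * ((k + 1) * q ^ k)) := by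
    intro k
    rw [lintegral_const_mul _ (hf k).ennreal_ofReal]
    refine (mul_le_mul_right (hint k) _).trans (le_of_eq ?_)
    rw [← ENNReal.ofReal_mul (by positivity)]
    congr 1
    have : (q ^ 2) ^ k = q ^ k * q ^ k := by rw [← pow_mul, mul_comm 2 k, pow_mul, sq]
    rw [this]
    field_simp
  have hfin : ∫⁻ x, ∑' k, F k x ∂μ ≠ ⊤ := by
    rw [lintegral_tsum fun k => (hF k).aemeasurable]
    exact ne_top_of_le_ne_top hsum.tsum_ofReal_ne_top (ENNReal.tsum_le_tsum hle)
  filter_upwards [ae_lt_top (Measurable.tsum hF) hfin] with x hx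
  refine ⟨(∑' k, F k x).toReal, ENNReal.toReal_nonneg, fun k => ?_⟩
  have h1 : F k x ≤ ∑' k, F k x := ENNReal.le_tsum k
  rw [← ENNReal.ofReal_toReal hx.ne] at h1
  simp only [F] at h1
  rw [← ENNReal.ofReal_mul (by positivity), ENNReal.ofReal_le_ofReal_iff ENNReal.toReal_nonneg,
    inv_mul_le_iff₀ (by positivity)] at h1
  linarith

theorem norm_transfer_le_prod {R : Type*} [NormedRing R] [NormOneClass R] {A : ℕ → R} {b : ℕ → ℝ}
    (hb : ∀ n, ‖A n‖ ≤ b n) (n : ℕ) :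
    ‖transfer A 0 n‖ ≤ ∏ j ∈ Finset.range n, (1 + b j) := by
  induction n with
  | zero => simp [transfer]
  | succ n ih =>
    rw [transfer, Finset.prod_range_succ, mul_comm]
    have h1 : ‖1 + A (0 + n)‖ ≤ 1 + b n := by
      refine (norm_add_le _ _).trans ?_
      rw [norm_one, zero_add]
      linarith [hb n]
    exact (norm_mul_le _ _).trans (mul_le_mul h1 ih (norm_nonneg _) ((norm_nonneg _).trans h1))

/-- Ordered products are bounded, uniformly over all factors with prescribed norm bounds, when the
dyadic energies of the dyadic blocks decay geometrically. -/
theorem exists_norm_transfer_le {b : ℕ → ℝ} (hb : ∀ n, 0 ≤ b n) {K p : ℝ} (hK : 0 ≤ K)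
    (hp0 : 0 ≤ p) (hp1 : p < 1) (R : Type*) [NormedRing R] [NormOneClass R] :
    ∃ C : ℝ, ∀ A : ℕ → R, (∀ n, ‖A n‖ ≤ b n) →
      (∀ k, dyadicEnergy A k (2 ^ k) ≤ K * p ^ k) → ∀ n, ‖transfer A 0 n‖ ≤ C := by
  set r := √p with hr
  have hr0 : 0 ≤ r := Real.sqrt_nonneg p
  have hr1 : r < 1 := by rw [hr, Real.sqrt_lt' one_pos]; simpa using hp1
  let t : ℕ → ℝ := fun k => (k + 1) * (4 * (√K * r ^ k))
  have ht0 : ∀ k, 0 ≤ t k := fun k => by positivity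
  have ht : Summable t := by
    have h1 := summable_pow_mul_geometric_of_norm_lt_one 1 (r := r)
      (by rwa [Real.norm_of_nonneg hr0])
    have h2 := summable_geometric_of_lt_one hr0 hr1
    refine ((h1.add h2).mul_left (4 * √K)).congr fun k => ?_
    simp only [t, pow_one]
    ring
  obtain ⟨k₀, hk₀⟩ : ∃ k₀ : ℕ, ∀ k ≥ k₀, K * p ^ k ≤ 1 ∧ k * (3 * (K * p ^ k)) ≤ 1 := by
    have l1 : Filter.Tendsto (fun k : ℕ => K * p ^ k) Filter.atTop (nhds 0) := by
      simpa using (tendsto_pow_atTop_nhds_zero_of_lt_one hp0 hp1).const_mul K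
    have l2 : Filter.Tendsto (fun k : ℕ => k * (3 * (K * p ^ k))) Filter.atTop (nhds 0) := by
      have := (tendsto_self_mul_const_pow_of_lt_one hp0 hp1).const_mul (3 * K)
      rw [mul_zero] at this
      refine this.congr fun k => ?_
      ring
    exact Filter.eventually_atTop.1 ((l1.eventually_le_const one_pos).and
      (l2.eventually_le_const one_pos))
  set C₀ := ∏ j ∈ Finset.range (2 ^ k₀), (1 + b j)
  have hC₀ : 0 ≤ C₀ := Finset.prod_nonneg fun j _ => by linarith [hb j]
  refine ⟨C₀ * Real.exp (∑' k, t k), fun A hA hE n => ?_⟩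
  have hinit : ∀ n ≤ 2 ^ k₀, ‖transfer A 0 n‖ ≤ C₀ := fun n hn =>
    (norm_transfer_le_prod hA n).trans (Finset.prod_le_prod_of_subset_of_one_le
      (Finset.range_mono hn) (fun j _ => by linarith [hb j]) fun j _ _ => by linarith [hb j])
  have hblock : ∀ k ≥ k₀, ∀ m ≤ 2 ^ k, ‖transfer A (2 ^ k) m‖ ≤ Real.exp (t k) := by
    intro k hk m hm
    obtain ⟨h1, h2⟩ := hk₀ k hk
    have h0 : 0 ≤ K * p ^ k := by positivity
    have hN : (1 + 3 * (K * p ^ k)) ^ k ≤ 3 := by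
      calc (1 + 3 * (K * p ^ k)) ^ k ≤ Real.exp (3 * (K * p ^ k)) ^ k := by
            gcongr
            linarith [Real.add_one_le_exp (3 * (K * p ^ k))]
        _ = Real.exp (k * (3 * (K * p ^ k))) := (Real.exp_nat_mul _ _).symm
        _ ≤ Real.exp 1 := Real.exp_le_exp.2 h2
        _ ≤ 3 := by linarith [Real.exp_one_lt_d9]
    refine (norm_transfer_le_of_le_two_pow A h0 h1 hN k _ m le_rfl hm (hE k)).trans ?_
    have hsq : √(K * p ^ k) = √K * r ^ k := by
      rw [Real.sqrt_mul hK, hr, Real.sqrt_eq_rpow p, Real.sqrt_eq_rpow (p ^ k),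
        ← Real.rpow_natCast, ← Real.rpow_natCast, ← Real.rpow_mul hp0, ← Real.rpow_mul hp0,
        mul_comm (k : ℝ)]
    rw [hsq]
    calc (1 + 4 * (√K * r ^ k)) ^ (k + 1) ≤ Real.exp (4 * (√K * r ^ k)) ^ (k + 1) := by
          gcongr
          linarith [Real.add_one_le_exp (4 * (√K * r ^ k))]
      _ = Real.exp (t k) := by
          rw [← Real.exp_nat_mul]
          push_cast
          rfl
  have hdyadic : ∀ k ≥ k₀, ‖transfer A 0 (2 ^ k)‖
      ≤ C₀ * Real.exp (∑ j ∈ Finset.range k, t j) := by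
    intro k hk
    induction k, hk using Nat.le_induction with
    | base =>
      exact (hinit _ le_rfl).trans (le_mul_of_one_le_right hC₀
        (Real.one_le_exp (Finset.sum_nonneg fun j _ => ht0 j)))
    | succ k hk ih =>
      have e2 : 2 ^ (k + 1) = 2 ^ k + 2 ^ k := by ring
      rw [e2, transfer_add, zero_add, Finset.sum_range_succ, Real.exp_add, ← mul_assoc,
        mul_comm _ (Real.exp (t k))]
      exact (norm_mul_le _ _).trans (mul_le_mul (hblock k hk _ le_rfl) ih (norm_nonneg _)
        (Real.exp_pos _).le)
  rcases le_total n (2 ^ k₀) with hn | hn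
  · exact (hinit n hn).trans (le_mul_of_one_le_right hC₀ (Real.one_le_exp (tsum_nonneg ht0)))
  · have hn0 : n ≠ 0 := (lt_of_lt_of_le (by positivity) hn).ne'
    set k := Nat.log 2 n
    have hk : k₀ ≤ k := (Nat.le_log_iff_pow_le one_lt_two hn0).2 hn
    have hk1 : 2 ^ k ≤ n := Nat.pow_log_le_self 2 hn0
    have hk2 : n < 2 ^ (k + 1) := Nat.lt_pow_succ_log_self one_lt_two n
    obtain ⟨m, hm⟩ := Nat.exists_eq_add_of_le hk1
    have hmk : m ≤ 2 ^ k := by rw [pow_succ] at hk2; omega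
    have hsum : ∑ j ∈ Finset.range (k + 1), t j ≤ ∑' j, t j := ht.sum_le_tsum _ fun j _ => ht0 j
    calc ‖transfer A 0 n‖ = ‖transfer A (2 ^ k) m * transfer A 0 (2 ^ k)‖ := by
          rw [hm, transfer_add, zero_add]
      _ ≤ Real.exp (t k) * (C₀ * Real.exp (∑ j ∈ Finset.range k, t j)) :=
          (norm_mul_le _ _).trans (mul_le_mul (hblock k hk m hmk) (hdyadic k hk) (norm_nonneg _)
            (Real.exp_pos _).le)
      _ = C₀ * Real.exp (∑ j ∈ Finset.range (k + 1), t j) := by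
          rw [Finset.sum_range_succ, Real.exp_add]; ring
      _ ≤ C₀ * Real.exp (∑' j, t j) := by gcongr

end OPUC

namespace OPUC
open MeasureTheory

/-- The real-linear maps `w ↦ - conj (e^{iβ} e^{iη} α_n e^{inη}) conj w`, the increments of the
Szegő recurrence for `e^{-inη} Φ_n(e^{iη}, β)`. -/
noncomputable def szegoIncrement (α : ℕ → ℂ) (η β : ℝ) (n : ℕ) : ℂ →L[ℝ] ℂ :=
  (-starRingEnd ℂ (Complex.exp (Complex.I * β) * Complex.exp (Complex.I * η) * modulated α η n))
    • (Complex.conjCLE : ℂ →L[ℝ] ℂ)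

theorem norm_exp_I_mul_ofReal (x : ℝ) : ‖Complex.exp (Complex.I * x)‖ = 1 := by
  rw [mul_comm, Complex.norm_exp_ofReal_mul_I]

theorem norm_windowSum_szegoIncrement (α : ℕ → ℂ) (η β : ℝ) (a n : ℕ) :
    ‖windowSum (szegoIncrement α η β) a n‖ = ‖windowSum (modulated α η) a n‖ := by
  have h : windowSum (szegoIncrement α η β) a n
      = (-starRingEnd ℂ (Complex.exp (Complex.I * β) * Complex.exp (Complex.I * η)
        * windowSum (modulated α η) a n)) • (Complex.conjCLE : ℂ →L[ℝ] ℂ) := by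
    simp only [windowSum, szegoIncrement, ← Finset.sum_smul, Finset.mul_sum, map_sum,
      Finset.sum_neg_distrib]
  rw [h, norm_smul, Complex.conjCLE_norm, mul_one, norm_neg, RCLike.norm_conj, norm_mul, norm_mul,
    norm_exp_I_mul_ofReal, norm_exp_I_mul_ofReal, one_mul, one_mul]

theorem norm_szegoIncrement (α : ℕ → ℂ) (η β : ℝ) (n : ℕ) :
    ‖szegoIncrement α η β n‖ = ‖α n‖ := by
  have h := norm_windowSum_szegoIncrement α η β n 1
  have h1 : ‖Complex.exp (Complex.I * n * η)‖ = 1 := by simp [Complex.norm_exp]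
  simpa [windowSum, modulated, h1] using h

theorem eval_rotatedPoly_eq (α : ℕ → ℂ) (η β : ℝ) (n : ℕ) :
    (rotatedPoly α β n).eval (Complex.exp (Complex.I * η))
      = Complex.exp (Complex.I * η) ^ n * transfer (szegoIncrement α η β) 0 n 1 := by
  have hmod : ∀ n, modulated α η n = α n * Complex.exp (Complex.I * η) ^ n := by
    intro n
    rw [modulated, ← Complex.exp_nat_mul]
    congr 2
    ring
  set z := Complex.exp (Complex.I * η) with hz
  have hz1 : ‖z‖ = 1 := norm_exp_I_mul_ofReal η
  have hz0 : z ≠ 0 := Complex.exp_ne_zero _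
  have hzz : z * starRingEnd ℂ z = 1 := by rw [Complex.mul_conj', hz1]; simp
  have hinv : 1 / starRingEnd ℂ z = z := by
    rw [one_div, ← map_inv₀, Complex.inv_eq_conj hz1, Complex.conj_conj]
  induction n with
  | zero => simp [rotatedPoly, monicPoly, transfer]
  | succ n ih =>
    have hpow : z ^ n * starRingEnd ℂ z ^ n = 1 := by rw [← mul_pow, hzz, one_pow]
    rw [rotatedPoly] at ih ⊢
    rw [monicPoly, Polynomial.eval_sub, Polynomial.eval_mul, Polynomial.eval_mul,
      Polynomial.eval_X, Polynomial.eval_C, eval_szegoDual n _ (natDegree_monicPoly_le _ n) z hz0,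
      hinv, ih, transfer, zero_add]
    simp only [szegoIncrement, hmod, ← hz, mul_apply_eq_comp,
      add_apply, one_apply_eq_self, smul_apply,
      ContinuousLinearEquiv.coe_coe, Complex.conjCLE_apply, map_mul, map_pow, smul_eq_mul]
    linear_combination (z ^ n * starRingEnd ℂ (Complex.exp (Complex.I * β))
      * starRingEnd ℂ (α n) * starRingEnd ℂ z ^ n
      * starRingEnd ℂ (transfer (szegoIncrement α η β) 0 n 1)) * hzz

theorem pruferRadius_le_norm_transfer (α : ℕ → ℂ) (η β : ℝ) (n : ℕ) :
    pruferRadius α n η β ≤ ‖transfer (szegoIncrement α η β) 0 n‖ := by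
  rw [pruferRadius, eval_rotatedPoly_eq, norm_mul, norm_pow, norm_exp_I_mul_ofReal, one_pow,
    one_mul]
  simpa using (transfer (szegoIncrement α η β) 0 n).le_opNorm 1

theorem windowSum_sq_norm_le {α : ℕ → ℂ} {γ : ℝ} (hγ : 0 ≤ γ)
    (hdecay : Summable fun n : ℕ => (n : ℝ) ^ γ * ‖α n‖ ^ 2) {a : ℕ} (ha : 0 < a) (n : ℕ) :
    windowSum (fun n => ‖α n‖ ^ 2) a n
      ≤ (a : ℝ) ^ (-γ) * ∑' n : ℕ, (n : ℝ) ^ γ * ‖α n‖ ^ 2 := by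
  have ha' : (0 : ℝ) < a := Nat.cast_pos.2 ha
  have hnn : ∀ n : ℕ, 0 ≤ (n : ℝ) ^ γ * ‖α n‖ ^ 2 := fun n => by positivity
  have h1 : ∑ i ∈ Finset.range n, ((a + i : ℕ) : ℝ) ^ γ * ‖α (a + i)‖ ^ 2
      ≤ ∑' n : ℕ, (n : ℝ) ^ γ * ‖α n‖ ^ 2 := by
    have h := hdecay.sum_le_tsum ((Finset.range n).map (addLeftEmbedding a)) fun i _ => hnn i
    simpa only [Finset.sum_map, addLeftEmbedding_apply] using h
  refine le_trans ?_ (mul_le_mul_of_nonneg_left h1 (by positivity))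
  rw [windowSum, Finset.mul_sum]
  refine Finset.sum_le_sum fun i _ => ?_
  have h2 : (a : ℝ) ^ γ ≤ ((a + i : ℕ) : ℝ) ^ γ :=
    Real.rpow_le_rpow ha'.le (Nat.cast_le.2 (Nat.le_add_right a i)) hγ
  have h3 : 1 ≤ (a : ℝ) ^ (-γ) * ((a + i : ℕ) : ℝ) ^ γ := by
    rw [Real.rpow_neg ha'.le, inv_mul_eq_div, one_le_div (by positivity)]
    exact h2
  rw [← mul_assoc]
  exact le_mul_of_one_le_left (sq_nonneg _) h3

end OPUC

theorem theorem4p1 (α : ℕ → ℂ) (hα : ∀ n, ‖α n‖ < 1)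
    (γ : ℝ) (hγ0 : 0 < γ) (hγ1 : γ < 1)
    (hdecay : Summable fun n : ℕ => (n : ℝ) ^ γ * ‖α n‖ ^ 2)
    (ν : MeasureTheory.Measure ℝ) [MeasureTheory.IsFiniteMeasure ν]
    (δ : ℝ) (hδ : 0 < δ) (hsupp : ν (Set.Ioo δ (2 * Real.pi - δ))ᶜ = 0)
    (D : ℝ) (hD0 : 1 - γ < D) (hD1 : D < 1) (hHolder : OPUC.UniformlyHolder ν D) :
    ∀ᵐ η ∂ν, BddAbove
      {r : ℝ | ∃ β ∈ Set.Ico 0 (2 * Real.pi), ∃ n : ℕ, r = OPUC.pruferRadius α n η β} := by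
  obtain ⟨K, hK⟩ := hHolder
  have hpi := Real.pi_pos
  have hs : ∀ᵐ x ∂ν, x ∈ Set.Ioo 0 (2 * Real.pi) := by
    filter_upwards [MeasureTheory.mem_ae_iff.2 hsupp] with x hx
    exact ⟨hδ.trans hx.1, by linarith [hx.2]⟩
  set Ct : ℝ := K * (2 * Real.pi) ^ D * (1 + 4 * Real.pi) with hCt
  have hCt0 : 0 ≤ Ct := by positivity
  set T : ℝ := ∑' n : ℕ, (n : ℝ) ^ γ * ‖α n‖ ^ 2
  set q : ℝ := 2 ^ ((1 - D - γ) / 2) with hq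
  have hq0 : 0 < q := by positivity
  have hq1 : q < 1 := Real.rpow_lt_one_of_one_lt_of_neg one_lt_two (by linarith)
  have hint : ∀ k : ℕ, ∫⁻ η, ENNReal.ofReal
      (OPUC.dyadicEnergy (OPUC.modulated α η) k (2 ^ k)) ∂ν
      ≤ ENNReal.ofReal (Ct * T * ((k + 1) * (q ^ 2) ^ k)) := by
    intro k
    have hB : 0 ≤ Ct * ((2 : ℝ) ^ k) ^ (1 - D) := by positivity
    refine (OPUC.lintegral_dyadicEnergy_modulated_le hB (fun c d hd => ?_) α k (2 ^ k)
      le_rfl).trans (ENNReal.ofReal_le_ofReal ?_)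
    · refine (OPUC.lintegral_sq_norm_trigPoly_le hs (by linarith) hK c
        (pow_pos two_pos d)).trans (ENNReal.ofReal_le_ofReal ?_)
      push_cast
      gcongr
      linarith
    · have hw := OPUC.windowSum_sq_norm_le hγ0.le hdecay (a := 2 ^ k) (pow_pos two_pos k) (2 ^ k)
      have hqk : (q ^ 2) ^ k = ((2 : ℝ) ^ k) ^ (1 - D) * ((2 : ℝ) ^ k) ^ (-γ) := by
        rw [← Real.rpow_add (by positivity), ← Real.rpow_natCast 2 k, ← Real.rpow_mul two_pos.le,
          hq, ← Real.rpow_natCast, ← Real.rpow_natCast, ← Real.rpow_mul two_pos.le,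
          ← Real.rpow_mul two_pos.le]
        congr 1
        push_cast
        ring
      push_cast at hw
      calc ((k : ℝ) + 1) * (Ct * ((2 : ℝ) ^ k) ^ (1 - D)
            * OPUC.windowSum (fun n => ‖α n‖ ^ 2) (2 ^ k) (2 ^ k))
          ≤ ((k : ℝ) + 1) * (Ct * ((2 : ℝ) ^ k) ^ (1 - D) * (((2 : ℝ) ^ k) ^ (-γ) * T)) := by
            gcongr
        _ = Ct * T * ((k + 1) * (q ^ 2) ^ k) := by rw [hqk]; ring
  filter_upwards [OPUC.ae_exists_le_geometric
    (fun k => (OPUC.continuous_dyadicEnergy_modulated α k (2 ^ k)).measurable) hq0 hq1 hint]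
    with η hη
  obtain ⟨M, hM0, hM⟩ := hη
  obtain ⟨C, hC⟩ := OPUC.exists_norm_transfer_le (b := fun n => ‖α n‖)
    (fun n => norm_nonneg _) hM0 hq0.le hq1 (ℂ →L[ℝ] ℂ)
  refine ⟨C, ?_⟩
  rintro r ⟨β, -, n, rfl⟩
  refine (OPUC.pruferRadius_le_norm_transfer α η β n).trans
    (hC _ (fun n => (OPUC.norm_szegoIncrement α η β n).le) (fun k => ?_) n)
  rw [OPUC.dyadicEnergy_congr (OPUC.norm_windowSum_szegoIncrement α η β)]
  exact hM k
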